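/- Let $\Sigma$ be the real linear system $x_{k+1}=Ax_k+Bu_k$, $y_k=Cx_k+Du_k$ with $x_k\in\mathbb R^{n_x}$, $u_k\in\mathbb R^{n_u}$, $y_k\in\mathbb R^{n_y}$ and $(A,B)$ controllable, and let $\ell_\Sigma\ge 1$ be its observability index, i.e. the smallest $\ell\ge1$ for which the matrix with block rows $C,CA,\dots,CA^{\ell-1}$ has the same rank as the one with block rows $C,CA,\dots,CA^{n_x-1}$. Let $T\ge 1$ and $\bar T\ge \ell_\Sigma$ be integers and put $L=\bar T+T$. Frequency-domain data. Let $M,E\ge1$, $\hat\omega_k=\pi k/M$ for $0\le k\le M-1$, and let $(\hat U^e,\hat Y^e)$, $e=1,\dots,E$, be input-output spectra of $\Sigma$: there are $\hat X^e_k\in\mathbb C^{n_x}$ with $e^{j\hat\omega_k}\hat X^e_k=A\hat X^e_k+B\hat U^e_k$ and $\hat Y^e_k=C\hat X^e_k+D\hat U^e_k$ for all $0\le k\le M-1$, where $\hat U^e,\hat X^e,\hat Y^e$ are samples, at the frequencies $\hat\omega_k$, of spectra of real signals, i.e. of functions $V$ of the frequency with $V(-\omega)=\overline{V(\omega)}$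 (so that they are real at $\hat\omega_0=0$). For a collection $V=\{V^e\}$ of sequences let $\mathcal F_r(V_{[m,n]})$ be the matrix with the block columns $[1,e^{j\hat\omega_k},\dots,e^{j(r-1)\hat\omega_k}]^\top\otimes[V^1_k\ \cdots\ V^E_k]$, $k=m,\dots,n$, and $\Phi_r(V)=[\,\mathcal F_r(V_{[0,M-1]})\ \ \overline{\mathcal F_r(V_{[1,M-1]})}\,]$. The collection $V$ is called collectively persistently exciting (CPE) of order $r$ if $1\le r\le E(2M-1)$ and $\Phi_r(V)$ has full row rank. Time-domain data. Let $(\hat u_{[0,N-1]},\hat y_{[0,N-1]})$ be an input-output trajectory of $\Sigma$ of length $N$. Let $H_r(v)$ be the Hankel matrix of depth $r$ of a sequence $v_{[0,N-1]}$, with the columns $(v_i,\dots,v_{i+r-1})$, $0\le i\le N-r$; $v$ is called persistently exciting (PE) of order $r$ if $1\le r\le N$ and $H_r(v)$ has full row rank. Assume that $\{\hat U^e\}_e$ is CPE and $\hat u$ is PE, both of order $\bar T+T+n_x$. Let $\ell:\mathbb R^{n_y}\times\mathbb R^{n_u}\to\mathbb R_{\ge0}$ be a stage cost, $\mathbb U\subseteq\mathbb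 R^{n_u}$ and $\mathbb Y\subseteq\mathbb R^{n_y}$ sets, and $\lambda_\sigma>0$. At time $k\in\mathbb Z$, given the past $(u_{[k-\bar T,k-1]},y_{[k-\bar T,k-1]})$, both FreePC and DeePC (with the regularization weights $\lambda_G$ of $\|G\|_1$ and $\lambda_g$ of $\|g\|_1$ set to zero) minimize $$\lambda_\sigma\|\sigma\|_1+\sum_{i=0}^{T-1}\ell(y_{i,k},u_{i,k})$$ subject to $u_{i,k}\in\mathbb U$, $y_{i,k}\in\mathbb Y$ for $0\le i\le T-1$ and $$\begin{bmatrix}u_{[k-\bar T,k-1]}\\u_{[0,T-1],k}\\y_{[k-\bar T,k-1]}+\sigma\\y_{[0,T-1],k}\end{bmatrix}=\begin{bmatrix}\Phi_L(\hat U)\\\Phi_L(\hat Y)\end{bmatrix}\begin{bmatrix}G_0\\G_1\\\overline{G_1}\end{bmatrix}\ \text{(FreePC)},\qquad\text{resp.}\quad \cdots=\begin{bmatrix}H_L(\hat u)\\H_L(\hat y)\end{bmatrix}g\ \text{(DeePC)},$$ over $u_{[0,T-1],k}$, $y_{[0,T-1],k}$, $\sigma\in\mathbb R^{\bar Tn_y}$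 and $G_0\in\mathbb R^E$, $G_1\in\mathbb C^{E(M-1)}$, resp. $g\in\mathbb R^{N-L+1}$. Then, for every past sequence and every $k\in\mathbb Z$, the two problems have the same set of pairs $(u_{[0,T-1],k},y_{[0,T-1],k})$ of optimal control actions and corresponding output sequences. Moreover, the two data matrices describe the same set of real vectors: $$\Big\{\begin{bmatrix}\Phi_L(\hat U)\\\Phi_L(\hat Y)\end{bmatrix}\begin{bmatrix}G_0\\G_1\\\overline{G_1}\end{bmatrix}\in\mathbb R^{L(n_u+n_y)} : G_0\in\mathbb R^E,\ G_1\in\mathbb C^{E(M-1)}\Big\}=\Big\{\begin{bmatrix}H_L(\hat u)\\H_L(\hat y)\end{bmatrix}g : g\in\mathbb R^{N-L+1}\Big\}.$$ -/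

import Mathlib

open scoped NNReal Matrix

noncomputable section

/-- The real discrete-time linear time-invariant system
`x (k+1) = A x k + B u k`, `y k = C x k + D u k`. -/
structure LTISystem (nx nu ny : ℕ) where
  A : Matrix (Fin nx) (Fin nx) ℝ
  B : Matrix (Fin nx) (Fin nu) ℝ
  C : Matrix (Fin ny) (Fin nx) ℝ
  D : Matrix (Fin ny) (Fin nu) ℝ

/-- A matrix has full row rank if its rows are linearly independent. -/
def FullRowRank {m n 𝕜 : Type*} [Field 𝕜] (A : Matrix m n 𝕜) : Prop :=
  LinearIndependent 𝕜 A.row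

namespace LTISystem

variable {nx nu ny : ℕ} (S : LTISystem nx nu ny)

/-- The controllability matrix `[B, A B, …, A ^ (nx - 1) B]`. -/
def ctrbMatrix : Matrix (Fin nx) (Fin nx × Fin nu) ℝ :=
  Matrix.of fun a p => (S.A ^ (p.1 : ℕ) * S.B) a p.2

/-- The pair `(A, B)` is controllable. -/
def Controllable : Prop := FullRowRank S.ctrbMatrix

/-- The observability matrix with block rows `C, C A, …, C A ^ (l - 1)`. -/
def obsMatrix (l : ℕ) : Matrix (Fin l × Fin ny) (Fin nx) ℝ :=
  Matrix.of fun p b => (S.C * S.A ^ (p.1 : ℕ)) p.2 b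

/-- The observability index: the smallest `l ≥ 1` for which the observability matrix of depth `l`
has the same rank as the one of depth `nx`. -/
def obsIndex : ℕ :=
  sInf {l : ℕ | 1 ≤ l ∧ (S.obsMatrix l).rank = (S.obsMatrix nx).rank}

/-- `(u, y)` is an input-output trajectory of length `N` of the system. -/
def IsIOTrajectory {N : ℕ} (u : Fin N → Fin nu → ℝ) (y : Fin N → Fin ny → ℝ) : Prop :=
  ∃ x : Fin N → Fin nx → ℝ,
    (∀ (k : ℕ) (hk : k + 1 < N),
      x ⟨k + 1, hk⟩ =
        S.A *ᵥ x ⟨k, Nat.lt_of_succ_lt hk⟩ + S.B *ᵥ u ⟨k, Nat.lt_of_succ_lt hk⟩) ∧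
    ∀ k, y k = S.C *ᵥ x k + S.D *ᵥ u k

end LTISystem

/-! ### Frequency-domain data -/

/-- The frequency grid `ω k = π k / M`, `k = 0, …, M - 1`. -/
def gridFreq {M : ℕ} (k : Fin M) : ℝ := Real.pi * (k : ℕ) / M

/-- `V` consists of samples on the frequency grid of a spectrum of a real-valued signal, that is, of
a function of the frequency with `W (-ω) = conj (W ω)`. As the grid lies in `[0, π)`, this amounts
to `V` being real at the frequency `0`. -/
def IsSampledSpectrum {M n : ℕ} (V : Fin M → Fin n → ℂ) : Prop :=
  ∃ W : ℝ → Fin n → ℂ, (∀ ω, W (-ω) = star (W ω)) ∧ ∀ k, V k = W (gridFreq k)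

/-- `(U, Y)` is an input-output spectrum of the system. -/
def LTISystem.IsIOSpectrum {nx nu ny M : ℕ} (S : LTISystem nx nu ny)
    (U : Fin M → Fin nu → ℂ) (Y : Fin M → Fin ny → ℂ) : Prop :=
  IsSampledSpectrum U ∧ IsSampledSpectrum Y ∧
  ∃ X : Fin M → Fin nx → ℂ, IsSampledSpectrum X ∧ ∀ k,
    Complex.exp (Complex.I * gridFreq k) • X k =
      S.A.map Complex.ofReal *ᵥ X k + S.B.map Complex.ofReal *ᵥ U k ∧
    Y k = S.C.map Complex.ofReal *ᵥ X k + S.D.map Complex.ofReal *ᵥ U k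

/-- The indices of the nonzero frequencies, `1, …, M - 1`. -/
abbrev NonzeroFreq (M : ℕ) : Type := {k : Fin M // 0 < (k : ℕ)}

/-- The matrix with one block column `W_L (exp (j ω k)) ⊗ [V ^ 1 k, …, V ^ E k]` for each frequency
index `k = f i`, where `W_L z = [1, z, …, z ^ (L - 1)]ᵀ`. -/
def freqMatrix {E M n : ℕ} {ι : Type*} (L : ℕ) (f : ι → Fin M) (V : Fin E → Fin M → Fin n → ℂ) :
    Matrix (Fin L × Fin n) (ι × Fin E) ℂ :=
  Matrix.of fun p q =>
    Complex.exp (Complex.I * gridFreq (f q.1)) ^ (p.1 : ℕ) * V q.2 (f q.1) p.2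

/-- The matrix `[F_L (V over 0, …, M - 1), conj (F_L (V over 1, …, M - 1))]`. -/
def symFreqMatrix {E M n : ℕ} (L : ℕ) (V : Fin E → Fin M → Fin n → ℂ) :
    Matrix (Fin L × Fin n) ((Fin M × Fin E) ⊕ (NonzeroFreq M × Fin E)) ℂ :=
  Matrix.fromCols (freqMatrix L id V) ((freqMatrix L (Subtype.val : NonzeroFreq M → Fin M) V).map star)

/-- Collective persistence of excitation of order `L` of `E` complex sequences of length `M`. -/
def IsCPE {E M n : ℕ} (L : ℕ) (V : Fin E → Fin M → Fin n → ℂ) : Prop :=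
  1 ≤ L ∧ L ≤ E * (2 * M - 1) ∧ FullRowRank (symFreqMatrix L V)

/-- The frequency-domain data matrix of depth `L`. -/
def freqDataMatrix {E M nu ny : ℕ} (L : ℕ)
    (U : Fin E → Fin M → Fin nu → ℂ) (Y : Fin E → Fin M → Fin ny → ℂ) :
    Matrix ((Fin L × Fin nu) ⊕ (Fin L × Fin ny))
      ((Fin M × Fin E) ⊕ (NonzeroFreq M × Fin E)) ℂ :=
  Matrix.fromRows (symFreqMatrix L U) (symFreqMatrix L Y)

/-- The vector `G = (G₀, G₁, conj G₁)`. -/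
def symVec {E M : ℕ} (G0 : Fin E → ℝ) (G1 : NonzeroFreq M × Fin E → ℂ) :
    (Fin M × Fin E) ⊕ (NonzeroFreq M × Fin E) → ℂ :=
  Sum.elim
    (fun q => if h : 0 < (q.1 : ℕ) then G1 (⟨q.1, h⟩, q.2) else (G0 q.2 : ℂ))
    (fun q => star (G1 q))

/-! ### Time-domain data -/

/-- The Hankel matrix of depth `L` generated by `v 0, …, v (N - 1)`; it has `N - L + 1` columns. -/
def hankel {N n : ℕ} (L : ℕ) (v : Fin N → Fin n → ℝ) :
    Matrix (Fin L × Fin n) (Fin (N + 1 - L)) ℝ :=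
  Matrix.of fun p j => v ⟨(p.1 : ℕ) + (j : ℕ), by have := p.1.isLt; have := j.isLt; omega⟩ p.2

/-- Persistence of excitation of order `L` of a real sequence of length `N`. -/
def IsPE {N n : ℕ} (L : ℕ) (v : Fin N → Fin n → ℝ) : Prop :=
  1 ≤ L ∧ L ≤ N ∧ FullRowRank (hankel L v)

/-- The time-domain data matrix of depth `L`. -/
def timeDataMatrix {N nu ny : ℕ} (L : ℕ)
    (u : Fin N → Fin nu → ℝ) (y : Fin N → Fin ny → ℝ) :
    Matrix ((Fin L × Fin nu) ⊕ (Fin L × Fin ny)) (Fin (N + 1 - L)) ℝ :=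
  Matrix.fromRows (hankel L u) (hankel L y)

/-! ### The two predictive control problems -/

/-- The vectorized pair of sequences `(u 0, …, u (L-1), y 0, …, y (L-1))`. -/
def stackIO {L nu ny : ℕ} (u : Fin L → Fin nu → ℝ) (y : Fin L → Fin ny → ℝ) :
    (Fin L × Fin nu) ⊕ (Fin L × Fin ny) → ℝ :=
  Sum.elim (fun p => u p.1 p.2) (fun p => y p.1 p.2)

/-- The window `v (k - Tp), …, v (k - 1)` of a signal. -/
def pastWindow {n : ℕ} (Tp : ℕ) (v : ℤ → Fin n → ℝ) (k : ℤ) : Fin Tp → Fin n → ℝ :=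
  fun i => v (k - Tp + (i : ℕ))

/-- What the two control problems have in common: the stage cost, the sets of admissible inputs and
outputs, and the weight of the slack variable. -/
structure ControlSpec (nu ny : ℕ) where
  stageCost : (Fin ny → ℝ) → (Fin nu → ℝ) → ℝ≥0
  inputs : Set (Fin nu → ℝ)
  outputs : Set (Fin ny → ℝ)
  slackWeight : ℝ

namespace ControlSpec

variable {nu ny : ℕ} (P : ControlSpec nu ny)

/-- The part of the cost shared by the two problems:
`slackWeight * ‖σ‖₁ + ∑ i, stageCost (y i) (u i)`. -/
def baseCost {Tp T : ℕ} (u : Fin T → Fin nu → ℝ) (y : Fin T → Fin ny → ℝ)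
    (σ : Fin Tp → Fin ny → ℝ) : ℝ :=
  P.slackWeight * (∑ i, ∑ a, |σ i a|) + ∑ i, (P.stageCost (y i) (u i) : ℝ)

/-- The input and output constraints. -/
def Admissible {T : ℕ} (u : Fin T → Fin nu → ℝ) (y : Fin T → Fin ny → ℝ) : Prop :=
  ∀ i, u i ∈ P.inputs ∧ y i ∈ P.outputs

/-- The constraints of the DeePC problem with data `(ud, yd)` and past `(up, yp)`, for the decision
variables `u, y, g, σ`. -/
def DeePCFeasible {N Tp T : ℕ} (ud : Fin N → Fin nu → ℝ) (yd : Fin N → Fin ny → ℝ)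
    (up : Fin Tp → Fin nu → ℝ) (yp : Fin Tp → Fin ny → ℝ)
    (u : Fin T → Fin nu → ℝ) (y : Fin T → Fin ny → ℝ)
    (g : Fin (N + 1 - (Tp + T)) → ℝ) (σ : Fin Tp → Fin ny → ℝ) : Prop :=
  stackIO (Fin.append up u) (Fin.append (yp + σ) y) = timeDataMatrix (Tp + T) ud yd *ᵥ g ∧
  P.Admissible u y

/-- The cost of the DeePC problem, with weight `lg` of the 1-norm of `g`. -/
def deePCCost {m Tp T : ℕ} (lg : ℝ) (u : Fin T → Fin nu → ℝ) (y : Fin T → Fin ny → ℝ)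
    (g : Fin m → ℝ) (σ : Fin Tp → Fin ny → ℝ) : ℝ :=
  P.baseCost u y σ + lg * ∑ i, |g i|

/-- The set of optimal control actions with their output sequences, `(u, y)`, of the DeePC
problem. -/
def deePCOptimal {N Tp : ℕ} (T : ℕ) (lg : ℝ)
    (ud : Fin N → Fin nu → ℝ) (yd : Fin N → Fin ny → ℝ)
    (up : Fin Tp → Fin nu → ℝ) (yp : Fin Tp → Fin ny → ℝ) :
    Set ((Fin T → Fin nu → ℝ) × (Fin T → Fin ny → ℝ)) :=
  {p | ∃ g σ, P.DeePCFeasible ud yd up yp p.1 p.2 g σ ∧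
    ∀ (u' : Fin T → Fin nu → ℝ) (y' : Fin T → Fin ny → ℝ) g' σ', P.DeePCFeasible ud yd up yp u' y' g' σ' →
      P.deePCCost lg p.1 p.2 g σ ≤ P.deePCCost lg u' y' g' σ'}

/-- The constraints of the FreePC problem with data `(Ud, Yd)` and past `(up, yp)`, for the decision
variables `u, y, G0, G1, σ`. -/
def FreePCFeasible {E M Tp T : ℕ}
    (Ud : Fin E → Fin M → Fin nu → ℂ) (Yd : Fin E → Fin M → Fin ny → ℂ)
    (up : Fin Tp → Fin nu → ℝ) (yp : Fin Tp → Fin ny → ℝ)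
    (u : Fin T → Fin nu → ℝ) (y : Fin T → Fin ny → ℝ)
    (G0 : Fin E → ℝ) (G1 : NonzeroFreq M × Fin E → ℂ) (σ : Fin Tp → Fin ny → ℝ) : Prop :=
  (fun r => (stackIO (Fin.append up u) (Fin.append (yp + σ) y) r : ℂ)) =
    freqDataMatrix (Tp + T) Ud Yd *ᵥ symVec G0 G1 ∧
  P.Admissible u y

/-- The cost of the FreePC problem, with weight `lG` of the 1-norm of `G = (G₀, G₁, conj G₁)`. -/
def freePCCost {E M Tp T : ℕ} (lG : ℝ) (u : Fin T → Fin nu → ℝ) (y : Fin T → Fin ny → ℝ)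
    (G0 : Fin E → ℝ) (G1 : NonzeroFreq M × Fin E → ℂ) (σ : Fin Tp → Fin ny → ℝ) : ℝ :=
  P.baseCost u y σ + lG * ∑ i, ‖symVec G0 G1 i‖

/-- The set of optimal control actions with their output sequences, `(u, y)`, of the FreePC
problem. -/
def freePCOptimal {E M Tp : ℕ} (T : ℕ) (lG : ℝ)
    (Ud : Fin E → Fin M → Fin nu → ℂ) (Yd : Fin E → Fin M → Fin ny → ℂ)
    (up : Fin Tp → Fin nu → ℝ) (yp : Fin Tp → Fin ny → ℝ) :
    Set ((Fin T → Fin nu → ℝ) × (Fin T → Fin ny → ℝ)) :=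
  {p | ∃ G0 G1 σ, P.FreePCFeasible Ud Yd up yp p.1 p.2 G0 G1 σ ∧
    ∀ (u' : Fin T → Fin nu → ℝ) (y' : Fin T → Fin ny → ℝ) G0' G1' σ',
      P.FreePCFeasible Ud Yd up yp u' y' G0' G1' σ' →
      P.freePCCost lG p.1 p.2 G0 G1 σ ≤ P.freePCCost lG u' y' G0' G1' σ'}

end ControlSpec

end

/-!
Both data matrices generate exactly the input-output trajectories of length `L = Tp + T` of the
system, that is, the range of the linear map `LTISystem.ioMap` taking an input sequence and an
initial state to the trajectory. As the two problems differ only in how they parametrize this set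
when the regularization weights vanish, they have the same optimal pairs.

That data generate all trajectories is Willems' fundamental lemma, proved here for a family of real
trajectories that jointly excite the order `L + nx` (`span_windows_eq_top`). In its dual form
(`eq_zero_of_annihilates_windows`), a row that annihilates the windows at all times `s ≤ nx` is
combined over `s` with the coefficients of the characteristic polynomial of `A`; this eliminates the
initial state and leaves a row annihilating all inputs of length `L + nx`, which excitation forces to
vanish. The row itself is then zero by a triangular elimination and controllability.

In the time domain the family consists of the segments of the data (`range_timeDataMatrix`). In the
frequency domain it consists of the real trajectories `Re (c z ^ t U)` with `c : ℂ` and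
`z = exp (j ω k)`, and the conjugate-symmetric coefficients `(G₀, G₁, conj G₁)` produce precisely the
sums of real parts of complex multiples of the columns (`freqSubmodule_eq_range`).
-/

noncomputable section

/-! ### Willems' fundamental lemma, dual form -/

variable {𝕜 : Type*} [Field 𝕜] {n m : ℕ}

theorem state_eq_pow_add_sum (A : Matrix (Fin n) (Fin n) 𝕜) (B : Matrix (Fin n) (Fin m) 𝕜)
    {u : ℕ → Fin m → 𝕜} {x : ℕ → Fin n → 𝕜} {s : ℕ}
    (hx : ∀ t < s, x (t + 1) = A *ᵥ x t + B *ᵥ u t) :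
    x s = A ^ s *ᵥ x 0 + ∑ r ∈ Finset.range s, (A ^ (s - 1 - r) * B) *ᵥ u r := by
  induction s with
  | zero => simp
  | succ s ih =>
    rw [hx s (Nat.lt_succ_self s), ih fun t ht => hx t (by omega), Finset.sum_range_succ,
      Matrix.mulVec_add, Matrix.mulVec_mulVec, ← pow_succ', Matrix.mulVec_sum, add_assoc]
    congr 2
    · refine Finset.sum_congr rfl fun r hr => ?_
      have hr := Finset.mem_range.1 hr
      rw [Matrix.mulVec_mulVec, ← Matrix.mul_assoc, ← pow_succ']
      congr 3
      omega
    · simp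

theorem sum_charpoly_coeff_smul_pow (A : Matrix (Fin n) (Fin n) 𝕜) :
    ∑ s ∈ Finset.range (n + 1), A.charpoly.coeff s • A ^ s = 0 := by
  have h := A.aeval_self_charpoly
  rwa [Polynomial.aeval_eq_sum_range, Matrix.charpoly_natDegree_eq_dim, Fintype.card_fin] at h

theorem charpoly_coeff_dim (A : Matrix (Fin n) (Fin n) 𝕜) : A.charpoly.coeff n = 1 := by
  have h := A.charpoly_monic.coeff_natDegree
  rwa [Matrix.charpoly_natDegree_eq_dim, Fintype.card_fin] at h

/-- The coefficient of `u r` in `ξ ⬝ᵥ x s + ∑ t, η t ⬝ᵥ u (s + t)` once `x s` is expressed through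
`x 0` and `u 0, …, u (s - 1)`. -/
def shiftedRow (A : Matrix (Fin n) (Fin n) 𝕜) (B : Matrix (Fin n) (Fin m) 𝕜)
    (ξ : Fin n → 𝕜) (η : ℕ → Fin m → 𝕜) (s r : ℕ) : Fin m → 𝕜 :=
  if r < s then ξ ᵥ* (A ^ (s - 1 - r) * B) else η (r - s)

theorem dotProduct_state_add_sum (A : Matrix (Fin n) (Fin n) 𝕜) (B : Matrix (Fin n) (Fin m) 𝕜)
    {u : ℕ → Fin m → 𝕜} {x : ℕ → Fin n → 𝕜} {L N s : ℕ} (hs : L + s ≤ N)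
    (hx : ∀ t < s, x (t + 1) = A *ᵥ x t + B *ᵥ u t)
    (ξ : Fin n → 𝕜) {η : ℕ → Fin m → 𝕜} (hη : ∀ t, L ≤ t → η t = 0) :
    ξ ⬝ᵥ x s + ∑ t ∈ Finset.range L, η t ⬝ᵥ u (s + t) =
      ξ ⬝ᵥ (A ^ s *ᵥ x 0) + ∑ r ∈ Finset.range N, shiftedRow A B ξ η s r ⬝ᵥ u r := by
  obtain ⟨d, rfl⟩ := Nat.exists_eq_add_of_le hs
  rw [state_eq_pow_add_sum A B hx, dotProduct_add, add_assoc, show L + s + d = s + (L + d) by ring,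
    Finset.sum_range_add _ s, Finset.sum_range_add _ L, dotProduct_sum]
  congr 1
  have tail : ∑ t ∈ Finset.range d,
      shiftedRow A B ξ η s (s + (L + t)) ⬝ᵥ u (s + (L + t)) = 0 :=
    Finset.sum_eq_zero fun t _ => by
      rw [shiftedRow, if_neg (by omega), hη _ (by omega), zero_dotProduct]
  rw [tail, add_zero]
  congr 1
  · refine Finset.sum_congr rfl fun r hr => ?_
    rw [shiftedRow, if_pos (Finset.mem_range.1 hr), Matrix.dotProduct_mulVec]
  · refine Finset.sum_congr rfl fun t _ => ?_
    rw [shiftedRow, if_neg (by omega), Nat.add_sub_cancel_left]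

/-- The dual form of Willems' fundamental lemma. A row `(ξ, η)` that annihilates the windows
`(x s, u s, …, u (s + L - 1))`, `s ≤ n`, of every member of a family of trajectories vanishes,
if the inputs of the family excite the order `L + n` (`hu`) and `(A, B)` is controllable (`hAB`).
Only finitely many values of the sequences matter. -/
theorem eq_zero_of_annihilates_windows {J : Type*}
    (A : Matrix (Fin n) (Fin n) 𝕜) (B : Matrix (Fin n) (Fin m) 𝕜)
    (hAB : ∀ ξ : Fin n → 𝕜, (∀ i < n, ξ ᵥ* (A ^ i * B) = 0) → ξ = 0)
    {u : J → ℕ → Fin m → 𝕜} {x : J → ℕ → Fin n → 𝕜} {L : ℕ}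
    (hx : ∀ j, ∀ t < n, x j (t + 1) = A *ᵥ x j t + B *ᵥ u j t)
    (hu : ∀ ζ : ℕ → Fin m → 𝕜,
      (∀ j, ∑ r ∈ Finset.range (L + n), ζ r ⬝ᵥ u j r = 0) → ∀ r < L + n, ζ r = 0)
    {ξ : Fin n → 𝕜} {η : ℕ → Fin m → 𝕜} (hη : ∀ t, L ≤ t → η t = 0)
    (h : ∀ j, ∀ s ≤ n, ξ ⬝ᵥ x j s + ∑ t ∈ Finset.range L, η t ⬝ᵥ u j (s + t) = 0) :
    ξ = 0 ∧ η = 0 := by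
  set α : ℕ → 𝕜 := A.charpoly.coeff
  have hαn : α n = 1 := charpoly_coeff_dim A
  -- Weighting the windows by the coefficients of the characteristic polynomial cancels the initial
  -- state (Cayley–Hamilton), which leaves a row annihilating all inputs of length `L + n`.
  have key : ∀ r < L + n, ∑ s ∈ Finset.range (n + 1), α s • shiftedRow A B ξ η s r = 0 := by
    refine hu _ fun j => ?_
    have h0 : ∑ s ∈ Finset.range (n + 1), α s * (ξ ⬝ᵥ (A ^ s *ᵥ x j 0)) = 0 := by
      have := congrArg (fun Q : Matrix (Fin n) (Fin n) 𝕜 => ξ ⬝ᵥ (Q *ᵥ x j 0))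
        (sum_charpoly_coeff_smul_pow A)
      simpa [Matrix.sum_mulVec, dotProduct_sum, Matrix.smul_mulVec] using this
    have h1 : ∑ s ∈ Finset.range (n + 1), α s * (ξ ⬝ᵥ (A ^ s *ᵥ x j 0) +
        ∑ r ∈ Finset.range (L + n), shiftedRow A B ξ η s r ⬝ᵥ u j r) = 0 := by
      refine Finset.sum_eq_zero fun s hs => ?_
      have hs : s ≤ n := Nat.lt_succ_iff.1 (Finset.mem_range.1 hs)
      rw [← dotProduct_state_add_sum A B (by omega) (fun t ht => hx j t (by omega)) ξ hη, h j s hs,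
        mul_zero]
    simp only [mul_add, Finset.sum_add_distrib, h0, zero_add, Finset.mul_sum] at h1
    rw [Finset.sum_comm] at h1
    simpa [sum_dotProduct] using h1
  -- The coefficient of `u (n + t)` involves only `η t, …, η (t + n)`, the first with factor
  -- `α n = 1`, so `η` vanishes from the top down.
  have hη0 : ∀ d t, L ≤ t + d → η t = 0 := by
    intro d
    induction d with
    | zero => exact fun t ht => hη t ht
    | succ d ih =>
      intro t ht
      by_cases htL : L ≤ t
      · exact hη t htL
      have hk := key (n + t) (by omega)
      rw [Finset.sum_range_succ, Finset.sum_eq_zero, zero_add, hαn, one_smul, shiftedRow,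
        if_neg (by omega), Nat.add_sub_cancel_left] at hk
      · exact hk
      · intro s hs
        have hs := Finset.mem_range.1 hs
        rw [shiftedRow, if_neg (by omega), ih _ (by omega), smul_zero]
  have hη' : η = 0 := funext fun t => hη0 L t (by omega)
  refine ⟨hAB ξ fun i => ?_, hη'⟩
  -- With `η = 0`, the coefficient of `u (n - 1 - i)` is `ξ A ^ i B` plus a combination of the
  -- `ξ A ^ i' B` with `i' < i`.
  induction i using Nat.strong_induction_on with
  | _ i ih =>
    intro hi
    have hk := key (n - 1 - i) (by omega)
    rw [Finset.sum_range_succ, Finset.sum_eq_zero, zero_add, hαn, one_smul, shiftedRow,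
      if_pos (by omega), show n - 1 - (n - 1 - i) = i by omega] at hk
    · exact hk
    · intro s hs
      have hs := Finset.mem_range.1 hs
      rw [shiftedRow]
      split_ifs with hlt
      · rw [ih (s - 1 - (n - 1 - i)) (by omega) (by omega), smul_zero]
      · simp [hη']

/-! ### The space of input-output trajectories -/

theorem FullRowRank.eq_zero_of_vecMul_eq_zero {ι κ 𝕜 : Type*} [Fintype ι] [Field 𝕜]
    {Q : Matrix ι κ 𝕜} (hQ : FullRowRank Q) {v : ι → 𝕜} (hv : v ᵥ* Q = 0) : v = 0 :=
  Matrix.vecMul_injective_iff.2 hQ (by simpa using hv)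

namespace LTISystem

variable {nx nu ny : ℕ} (S : LTISystem nx nu ny)

theorem Controllable.eq_zero {S : LTISystem nx nu ny} (hS : S.Controllable) {ξ : Fin nx → ℝ}
    (hξ : ∀ i < nx, ξ ᵥ* (S.A ^ i * S.B) = 0) : ξ = 0 :=
  FullRowRank.eq_zero_of_vecMul_eq_zero hS <| funext fun p => congrFun (hξ p.1 p.1.isLt) p.2

/-- The input at time `t`, as a function of the inputs at times `0, …, L - 1` and the initial state;
it is `0` for `t ≥ L`. -/
def inputMap (L t : ℕ) : (Fin L → Fin nu → ℝ) × (Fin nx → ℝ) →ₗ[ℝ] Fin nu → ℝ :=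
  if h : t < L then LinearMap.proj ⟨t, h⟩ ∘ₗ LinearMap.fst ℝ _ _ else 0

/-- The state at time `t`, as a function of the inputs at times `0, …, L - 1` and the initial
state. -/
def stateMap (L : ℕ) : ℕ → ((Fin L → Fin nu → ℝ) × (Fin nx → ℝ) →ₗ[ℝ] Fin nx → ℝ)
  | 0 => LinearMap.snd ℝ _ _
  | t + 1 => S.A.mulVecLin ∘ₗ stateMap L t + S.B.mulVecLin ∘ₗ inputMap L t

/-- The map taking the inputs at times `0, …, L - 1` and the initial state to the vectorized
input-output trajectory of length `L`. Its range is the set of all such trajectories. -/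
def ioMap (L : ℕ) : (Fin L → Fin nu → ℝ) × (Fin nx → ℝ) →ₗ[ℝ]
    ((Fin L × Fin nu) ⊕ (Fin L × Fin ny) → ℝ) :=
  LinearMap.pi <| Sum.elim
    (fun p => LinearMap.proj p.2 ∘ₗ inputMap L p.1)
    (fun p => LinearMap.proj p.2 ∘ₗ
      (S.C.mulVecLin ∘ₗ S.stateMap L p.1 + S.D.mulVecLin ∘ₗ inputMap L p.1))

theorem ioMap_eq_of_trajectory {L : ℕ} {u : ℕ → Fin nu → ℝ} {x : ℕ → Fin nx → ℝ}
    (hx : ∀ t, t + 1 < L → x (t + 1) = S.A *ᵥ x t + S.B *ᵥ u t) :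
    S.ioMap L (fun t => u t, x 0) =
      stackIO (fun t : Fin L => u t) (fun t : Fin L => S.C *ᵥ x t + S.D *ᵥ u t) := by
  have hu : ∀ t < L, inputMap L t ((fun t => u t : Fin L → Fin nu → ℝ), x 0) = u t := by
    intro t ht
    simp [inputMap, ht]
  have hst : ∀ t < L, S.stateMap L t ((fun t => u t : Fin L → Fin nu → ℝ), x 0) = x t := by
    intro t
    induction t with
    | zero => intro _; rfl
    | succ t ih =>
      intro ht
      simp [stateMap, ih (by omega), hu t (by omega), hx t ht]
  ext (p | p)
  · simp [ioMap, stackIO, hu]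
  · simp [ioMap, stackIO, hu, hst]

end LTISystem

theorem exists_dotProduct_eq {𝕜 : Type*} [Field 𝕜] {n : ℕ} (f : (Fin n → 𝕜) →ₗ[𝕜] 𝕜) :
    ∃ ξ : Fin n → 𝕜, ∀ v, f v = ξ ⬝ᵥ v :=
  ⟨fun i => f (Pi.single i 1), fun v => by
    conv_lhs => rw [pi_eq_sum_univ' v]
    simp [dotProduct, mul_comm]⟩

/-- Willems' fundamental lemma for a family of trajectories: if the inputs excite the order `L + n`,
then the windows of `L` inputs with the state at their beginning span all pairs of an input of
length `L` and an initial state. -/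
theorem span_windows_eq_top {𝕜 : Type*} [Field 𝕜] {n m : ℕ} {J : Type*}
    (A : Matrix (Fin n) (Fin n) 𝕜) (B : Matrix (Fin n) (Fin m) 𝕜)
    (hAB : ∀ ξ : Fin n → 𝕜, (∀ i < n, ξ ᵥ* (A ^ i * B) = 0) → ξ = 0)
    {u : J → ℕ → Fin m → 𝕜} {x : J → ℕ → Fin n → 𝕜} {L : ℕ}
    (hx : ∀ j, ∀ t < n, x j (t + 1) = A *ᵥ x j t + B *ᵥ u j t)
    (hu : ∀ ζ : ℕ → Fin m → 𝕜,
      (∀ j, ∑ r ∈ Finset.range (L + n), ζ r ⬝ᵥ u j r = 0) → ∀ r < L + n, ζ r = 0) :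
    Submodule.span 𝕜 {v : (Fin L → Fin m → 𝕜) × (Fin n → 𝕜) |
      ∃ j, ∃ s ≤ n, v = (fun t : Fin L => u j (s + t), x j s)} = ⊤ := by
  by_contra hne
  obtain ⟨f, hf, hle⟩ := Submodule.exists_le_ker_of_lt_top _ (lt_top_iff_ne_top.2 hne)
  obtain ⟨ξ, hξ⟩ := exists_dotProduct_eq (f ∘ₗ LinearMap.inr 𝕜 _ _)
  choose η hη using fun t : Fin L =>
    exists_dotProduct_eq (f ∘ₗ LinearMap.inl 𝕜 _ _ ∘ₗ LinearMap.single 𝕜 (fun _ => Fin m → 𝕜) t)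
  have hfv : ∀ w z, f (w, z) = ξ ⬝ᵥ z + ∑ t, η t ⬝ᵥ w t := by
    intro w z
    have hw : f (w, 0) = ∑ t, η t ⬝ᵥ w t := by
      have := map_sum (f ∘ₗ LinearMap.inl 𝕜 _ _) (fun t => Pi.single t (w t)) Finset.univ
      rw [Finset.univ_sum_single] at this
      simpa [← hη] using this
    rw [← hw, ← hξ, LinearMap.comp_apply, LinearMap.inr_apply, ← map_add]
    simp
  obtain ⟨h1, h2⟩ := eq_zero_of_annihilates_windows A B hAB hx hu
    (ξ := ξ) (η := fun t => if h : t < L then η ⟨t, h⟩ else 0)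
    (fun t ht => dif_neg (by omega)) fun j s hs => by
      have hker : f (fun t => u j (s + t), x j s) = 0 :=
        hle (Submodule.subset_span ⟨j, s, hs, rfl⟩)
      rw [hfv] at hker
      rw [← hker, Finset.sum_range]
      simp
  refine hf (LinearMap.ext fun v => ?_)
  have h3 : ∀ t : Fin L, η t = 0 := fun t => by simpa using congrFun h2 t
  simp [hfv v.1 v.2, h1, h3]

/-- A space of input-output trajectories of length `L` that contains all windows of an exciting
family is the space of all trajectories. -/
theorem LTISystem.eq_range_ioMap {nx nu ny : ℕ} (S : LTISystem nx nu ny) (hS : S.Controllable)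
    {J : Type*} {u : J → ℕ → Fin nu → ℝ} {x : J → ℕ → Fin nx → ℝ} {L : ℕ}
    (hx : ∀ j, ∀ t < nx, x j (t + 1) = S.A *ᵥ x j t + S.B *ᵥ u j t)
    (hu : ∀ ζ : ℕ → Fin nu → ℝ,
      (∀ j, ∑ r ∈ Finset.range (L + nx), ζ r ⬝ᵥ u j r = 0) → ∀ r < L + nx, ζ r = 0)
    {P : Submodule ℝ ((Fin L × Fin nu) ⊕ (Fin L × Fin ny) → ℝ)}
    (hP : P ≤ LinearMap.range (S.ioMap L))
    (hmem : ∀ j, ∀ s ≤ nx, S.ioMap L (fun t => u j (s + t), x j s) ∈ P) :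
    P = LinearMap.range (S.ioMap L) := by
  refine le_antisymm hP ?_
  rw [LinearMap.range_eq_map,
    ← span_windows_eq_top S.A S.B (fun _ => hS.eq_zero) hx hu, Submodule.map_span_le]
  rintro _ ⟨j, s, hs, rfl⟩
  exact hmem j s hs

theorem sum_dotProduct_eq_vecMul {n R : ℕ} {κ 𝕜 : Type*} [Field 𝕜] (ζ : ℕ → Fin n → 𝕜)
    (v : ℕ → Fin n → 𝕜) (Q : Matrix (Fin R × Fin n) κ 𝕜) (c : κ)
    (hQ : ∀ p, Q p c = v p.1 p.2) :
    ((fun p : Fin R × Fin n => ζ p.1 p.2) ᵥ* Q) c = ∑ r ∈ Finset.range R, ζ r ⬝ᵥ v r := by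
  simp [Matrix.vecMul, dotProduct, hQ, Fintype.sum_prod_type, Finset.sum_range]

/-! ### Trajectories generated by time-domain data -/

/-- The columns of the Hankel data matrix span the space of input-output trajectories. The exciting
family consists of the segments of length `L + nx` of the data, whose windows are the columns. -/
theorem range_timeDataMatrix {nx nu ny N L : ℕ} (hL : 1 ≤ L)
    (S : LTISystem nx nu ny) (hS : S.Controllable)
    {ud : Fin N → Fin nu → ℝ} {yd : Fin N → Fin ny → ℝ} (huy : S.IsIOTrajectory ud yd)
    (hPE : IsPE (L + nx) ud) :
    LinearMap.range (timeDataMatrix L ud yd).mulVecLin = LinearMap.range (S.ioMap L) := by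
  obtain ⟨-, hN, hrank⟩ := hPE
  obtain ⟨xd, hxd, hyd⟩ := huy
  -- The data are extended by `0` beyond time `N - 1`; no window below reaches that far.
  set u : ℕ → Fin nu → ℝ := fun t => if h : t < N then ud ⟨t, h⟩ else 0 with hu
  set x : ℕ → Fin nx → ℝ := fun t => if h : t < N then xd ⟨t, h⟩ else 0 with hx
  have hu' : ∀ t (h : t < N), u t = ud ⟨t, h⟩ := fun t h => dif_pos h
  have hx' : ∀ t (h : t < N), x t = xd ⟨t, h⟩ := fun t h => dif_pos h
  have hstep : ∀ t, t + 1 < N → x (t + 1) = S.A *ᵥ x t + S.B *ᵥ u t := fun t ht => by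
    rw [hx' _ ht, hx' t (by omega), hu' t (by omega), hxd t ht]
  have hcol : ∀ i : Fin (N + 1 - L),
      (timeDataMatrix L ud yd).col i = S.ioMap L (fun t => u (i + t), x i) := by
    intro i
    have hi := i.isLt
    have := S.ioMap_eq_of_trajectory (L := L) (u := fun t => u (i + t)) (x := fun t => x (i + t))
      fun t ht => hstep (i + t) (by omega)
    simp only [add_zero] at this
    rw [this]
    ext (p | p)
    · have hp := p.1.isLt
      simp [stackIO, timeDataMatrix, hankel, hu' (i + p.1) (by omega), Nat.add_comm]
    · have hp := p.1.isLt
      simp [stackIO, timeDataMatrix, hankel, hu' (i + p.1) (by omega), hx' (i + p.1) (by omega), hyd,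
        Nat.add_comm]
  refine S.eq_range_ioMap hS (J := Fin (N + 1 - (L + nx))) (u := fun j t => u (j + t))
    (x := fun j t => x (j + t)) (fun j t ht => hstep (j + t) (by have := j.isLt; omega)) ?_ ?_ ?_
  · intro ζ hζ r hr
    have h0 := hrank.eq_zero_of_vecMul_eq_zero (v := fun p => ζ p.1 p.2) <| funext fun j => by
      have hj := j.isLt
      rw [sum_dotProduct_eq_vecMul ζ (fun t => u (j + t)) _ j, hζ j]; · rfl
      intro p
      have hp := p.1.isLt
      simp [hankel, hu' (j + p.1) (by omega), Nat.add_comm]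
    exact funext fun a => congrFun h0 (⟨r, hr⟩, a)
  · rw [Matrix.range_mulVecLin, Submodule.span_le]
    rintro _ ⟨i, rfl⟩
    exact ⟨_, (hcol i).symm⟩
  · intro j s hs
    have hj := j.isLt
    have := hcol ⟨j + s, by omega⟩
    simp only [add_assoc] at this ⊢
    rw [← this, Matrix.range_mulVecLin]
    exact Submodule.subset_span ⟨_, rfl⟩

/-! ### Trajectories generated by frequency-domain data -/

/-- The real part of the complex vector `c • v`. -/
def rePart {ι : Type*} (c : ℂ) (v : ι → ℂ) : ι → ℝ := fun a => (c * v a).re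

theorem mulVec_rePart {p q : ℕ} (Q : Matrix (Fin p) (Fin q) ℝ) (c : ℂ) (v : Fin q → ℂ) :
    Q *ᵥ rePart c v = rePart c (Q.map Complex.ofReal *ᵥ v) := by
  ext a
  simp only [rePart, Matrix.mulVec, dotProduct, Finset.mul_sum, Complex.re_sum, Matrix.map_apply]
  refine Finset.sum_congr rfl fun b _ => ?_
  rw [mul_left_comm, Complex.re_ofReal_mul]

theorem rePart_add {ι : Type*} (c : ℂ) (v w : ι → ℂ) :
    rePart c (v + w) = rePart c v + rePart c w := by
  ext a; simp [rePart, mul_add]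

theorem rePart_mul {ι : Type*} (c z : ℂ) (v : ι → ℂ) :
    rePart (c * z) v = rePart c (z • v) := by
  ext a; simp [rePart, mul_assoc]

theorem IsSampledSpectrum.star_eq {M n : ℕ} {V : Fin M → Fin n → ℂ} (hV : IsSampledSpectrum V)
    {k : Fin M} (hk : (k : ℕ) = 0) : star (V k) = V k := by
  obtain ⟨W, hW, hVW⟩ := hV
  have h0 : gridFreq k = 0 := by simp [gridFreq, hk]
  rw [hVW, h0, ← hW, neg_zero]

variable {nx nu ny E M : ℕ}

theorem symVec_add (G0 G0' : Fin E → ℝ) (G1 G1' : NonzeroFreq M × Fin E → ℂ) :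
    symVec (G0 + G0') (G1 + G1') = symVec G0 G1 + symVec G0' G1' := by
  ext (q | q)
  · by_cases h : 0 < (q.1 : ℕ) <;> simp [symVec, h]
  · simp [symVec]

theorem symVec_smul (c : ℝ) (G0 : Fin E → ℝ) (G1 : NonzeroFreq M × Fin E → ℂ) :
    symVec (c • G0) (c • G1) = (c : ℂ) • symVec G0 G1 := by
  ext (q | q)
  · by_cases h : 0 < (q.1 : ℕ) <;> simp [symVec, h]
  · simp [symVec]

/-- The real vectors generated by the frequency-domain data matrix from the coefficient vectors
`(G₀, G₁, conj G₁)`. -/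
def freqSubmodule (L : ℕ) (Ud : Fin E → Fin M → Fin nu → ℂ) (Yd : Fin E → Fin M → Fin ny → ℂ) :
    Submodule ℝ ((Fin L × Fin nu) ⊕ (Fin L × Fin ny) → ℝ) where
  carrier := {w | ∃ G0 G1, (fun r => (w r : ℂ)) = freqDataMatrix L Ud Yd *ᵥ symVec G0 G1}
  add_mem' := by
    rintro v w ⟨G0, G1, hv⟩ ⟨G0', G1', hw⟩
    refine ⟨G0 + G0', G1 + G1', ?_⟩
    rw [symVec_add, Matrix.mulVec_add, ← hv, ← hw]
    ext r; simp
  zero_mem' := ⟨0, 0, by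
    have := symVec_smul 0 (0 : Fin E → ℝ) (0 : NonzeroFreq M × Fin E → ℂ)
    simp only [smul_zero, Complex.ofReal_zero, zero_smul] at this
    rw [this, Matrix.mulVec_zero]
    ext r; simp⟩
  smul_mem' := by
    rintro c w ⟨G0, G1, hw⟩
    refine ⟨c • G0, c • G1, ?_⟩
    rw [symVec_smul, Matrix.mulVec_smul, ← hw]
    ext r; simp

theorem freqDataMatrix_inr (L : ℕ) (Ud : Fin E → Fin M → Fin nu → ℂ)
    (Yd : Fin E → Fin M → Fin ny → ℂ) (r) (q : NonzeroFreq M × Fin E) :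
    freqDataMatrix L Ud Yd r (Sum.inr q) =
      star (freqDataMatrix L Ud Yd r (Sum.inl (q.1.1, q.2))) := by
  rcases r with r | r <;> rfl

/-- The real part of a complex multiple of a column is generated by a single entry of `G₁`, or, at the
frequency `0`, where the data are real, by a single entry of `G₀`. -/
theorem rePart_freqDataMatrix_mem (L : ℕ) {Ud : Fin E → Fin M → Fin nu → ℂ}
    {Yd : Fin E → Fin M → Fin ny → ℂ} (hU : ∀ e, IsSampledSpectrum (Ud e))
    (hY : ∀ e, IsSampledSpectrum (Yd e)) (c : ℂ) (q : Fin M × Fin E) :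
    rePart c ((freqDataMatrix L Ud Yd).col (Sum.inl q)) ∈ freqSubmodule L Ud Yd := by
  obtain ⟨k, e⟩ := q
  by_cases hk : 0 < (k : ℕ)
  · refine ⟨0, Pi.single (⟨k, hk⟩, e) (c / 2), ?_⟩
    have : symVec (0 : Fin E → ℝ) (Pi.single ((⟨k, hk⟩, e) : NonzeroFreq M × Fin E) (c / 2)) =
        Pi.single (Sum.inl (k, e)) (c / 2) + Pi.single (Sum.inr (⟨k, hk⟩, e)) (star (c / 2)) := by
      ext (⟨k', e'⟩ | ⟨k', e'⟩)
      · by_cases h : 0 < (k' : ℕ)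
        · simp [symVec, h, Pi.single_apply]
        · have : k' ≠ k := by rintro rfl; exact h hk
          simp [symVec, h, Pi.single_apply, this]
      · by_cases h : (k', e') = (⟨k, hk⟩, e)
        · rw [h]; simp [symVec, Complex.conj_ofNat]
        · simp [symVec, Pi.single_apply, h]
    rw [this, Matrix.mulVec_add, Matrix.mulVec_single, Matrix.mulVec_single]
    ext r
    simp only [Pi.add_apply, Pi.smul_apply, Matrix.col_apply, freqDataMatrix_inr, rePart,
      MulOpposite.smul_eq_mul_unop, MulOpposite.unop_op]
    rw [Complex.re_eq_add_conj]
    simp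
    ring
  · have hk0 : (k : ℕ) = 0 := by omega
    refine ⟨Pi.single e c.re, 0, ?_⟩
    have : symVec (Pi.single e c.re) (0 : NonzeroFreq M × Fin E → ℂ) =
        Pi.single (Sum.inl (k, e)) (c.re : ℂ) := by
      ext (⟨k', e'⟩ | ⟨k', e'⟩)
      · by_cases h : 0 < (k' : ℕ)
        · have : k' ≠ k := by rintro rfl; exact hk h
          simp [symVec, h, Pi.single_apply, this]
        · have : k' = k := Fin.ext (by omega)
          by_cases he : e' = e <;> simp [symVec, Pi.single_apply, this, he, hk]
      · simp [symVec]
    rw [this, Matrix.mulVec_single]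
    ext r
    have hreal : star (freqDataMatrix L Ud Yd r (Sum.inl (k, e))) =
        freqDataMatrix L Ud Yd r (Sum.inl (k, e)) := by
      have h0 : gridFreq k = 0 := by simp [gridFreq, hk0]
      rcases r with r | r
      · simpa [freqDataMatrix, symFreqMatrix, freqMatrix, h0] using
          congrFun ((hU e).star_eq hk0) r.2
      · simpa [freqDataMatrix, symFreqMatrix, freqMatrix, h0] using
          congrFun ((hY e).star_eq hk0) r.2
    obtain ⟨a, ha⟩ := Complex.conj_eq_iff_real.1 hreal
    simp [rePart, ha, mul_comm]

/-- The real vectors generated from the coefficients `(G₀, G₁, conj G₁)` are sums of real parts of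
complex multiples of the columns. -/
theorem freqSubmodule_le {L : ℕ} {Ud : Fin E → Fin M → Fin nu → ℂ}
    {Yd : Fin E → Fin M → Fin ny → ℂ}
    {Q : Submodule ℝ ((Fin L × Fin nu) ⊕ (Fin L × Fin ny) → ℝ)}
    (hQ : ∀ c q, rePart c ((freqDataMatrix L Ud Yd).col (Sum.inl q)) ∈ Q) :
    freqSubmodule L Ud Yd ≤ Q := by
  rintro w ⟨G0, G1, hw⟩
  have : w = ∑ i, rePart (symVec G0 G1 i) ((freqDataMatrix L Ud Yd).col i) := by
    ext r
    have := congrArg Complex.re (congrFun hw r)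
    rw [Matrix.mulVec, dotProduct, Complex.re_sum, Complex.ofReal_re] at this
    simp only [this, Finset.sum_apply, rePart, Matrix.col_apply, mul_comm]
  rw [this]
  refine Submodule.sum_mem _ ?_
  rintro (q | q) _
  · exact hQ _ _
  · convert hQ (G1 q) (q.1.1, q.2) using 1
    ext r
    simp [rePart, Matrix.col_apply, freqDataMatrix_inr, symVec]

/-- The frequency-domain data generate the space of input-output trajectories. The exciting family
consists of the trajectories `Re (c z ^ t U)` for all `c : ℂ` and all columns `(k, e)` of the data,
with `z = exp (j ω k)`; shifting such a trajectory in time by `s` replaces `c` by `c z ^ s`. -/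
theorem freqSubmodule_eq_range {L : ℕ} (S : LTISystem nx nu ny) (hS : S.Controllable)
    {Ud : Fin E → Fin M → Fin nu → ℂ} {Yd : Fin E → Fin M → Fin ny → ℂ}
    (hUY : ∀ e, S.IsIOSpectrum (Ud e) (Yd e)) (hCPE : IsCPE (L + nx) Ud) :
    freqSubmodule L Ud Yd = LinearMap.range (S.ioMap L) := by
  obtain ⟨-, -, hrank⟩ := hCPE
  choose hU hY Xd hX hdyn using hUY
  set z : Fin M → ℂ := fun k => Complex.exp (Complex.I * gridFreq k) with hz
  have hstep : ∀ c k e t, rePart (c * z k ^ (t + 1)) (Xd e k) =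
      S.A *ᵥ rePart (c * z k ^ t) (Xd e k) + S.B *ᵥ rePart (c * z k ^ t) (Ud e k) := by
    intro c k e t
    rw [pow_succ, ← mul_assoc, rePart_mul, (hdyn e k).1, rePart_add, mulVec_rePart, mulVec_rePart]
  have hcol : ∀ c k e, S.ioMap L (fun t => rePart (c * z k ^ (t : ℕ)) (Ud e k), rePart c (Xd e k)) =
      rePart c ((freqDataMatrix L Ud Yd).col (Sum.inl (k, e))) := by
    intro c k e
    have := S.ioMap_eq_of_trajectory (L := L) (u := fun t => rePart (c * z k ^ t) (Ud e k))
      (x := fun t => rePart (c * z k ^ t) (Xd e k)) fun t _ => hstep c k e t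
    rw [pow_zero, mul_one] at this
    rw [this]
    simp only [mulVec_rePart, ← rePart_add, ← (hdyn e k).2]
    ext (p | p) <;>
      simp [stackIO, rePart, freqDataMatrix, symFreqMatrix, freqMatrix, hz, mul_assoc]
  refine S.eq_range_ioMap hS (J := ℂ × Fin M × Fin E)
    (u := fun j t => rePart (j.1 * z j.2.1 ^ t) (Ud j.2.2 j.2.1))
    (x := fun j t => rePart (j.1 * z j.2.1 ^ t) (Xd j.2.2 j.2.1))
    (fun j t _ => hstep _ _ _ _) ?_ ?_ ?_
  · intro ζ hζ r hr
    have hinl : ∀ q, ((fun p : Fin (L + nx) × Fin nu => (ζ p.1 p.2 : ℂ)) ᵥ*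
        symFreqMatrix (L + nx) Ud) (Sum.inl q) = 0 := by
      rintro ⟨k, e⟩
      -- With `b` the pairing of `ζ` with a column, the choice `c = conj b` of the family turns the
      -- hypothesis into `|b| ^ 2 = 0`.
      set b := ((fun p : Fin (L + nx) × Fin nu => (ζ p.1 p.2 : ℂ)) ᵥ*
        symFreqMatrix (L + nx) Ud) (Sum.inl (k, e)) with hb
      have hre : (star b * b).re = 0 := by
        have hsum : b = ∑ r ∈ Finset.range (L + nx), (fun a => (ζ r a : ℂ)) ⬝ᵥ (z k ^ r • Ud e k) :=
          sum_dotProduct_eq_vecMul (fun r a => (ζ r a : ℂ))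
            (fun t => z k ^ t • Ud e k) _ _ fun p => rfl
        rw [← hζ (star b, k, e)]
        conv_lhs => enter [1, 2]; rw [hsum]
        rw [Finset.mul_sum, Complex.re_sum]
        refine Finset.sum_congr rfl fun r _ => ?_
        simp only [dotProduct, Finset.mul_sum, Complex.re_sum, rePart]
        refine Finset.sum_congr rfl fun a _ => ?_
        rw [mul_left_comm, Complex.re_ofReal_mul, Pi.smul_apply, smul_eq_mul, mul_assoc]
      rw [Complex.star_def, ← Complex.normSq_eq_conj_mul_self, Complex.ofReal_re] at hre
      exact Complex.normSq_eq_zero.1 hre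
    have h0 := hrank.eq_zero_of_vecMul_eq_zero (v := fun p => (ζ p.1 p.2 : ℂ)) <| funext <| by
      rintro (q | q)
      · exact hinl q
      -- The remaining columns are conjugates of those above, and `ζ` is real.
      · have := congrArg star (hinl (q.1.1, q.2))
        simpa [Matrix.vecMul, dotProduct, symFreqMatrix, freqMatrix] using this
    exact funext fun a => Complex.ofReal_eq_zero.1 (congrFun h0 (⟨r, hr⟩, a))
  · refine freqSubmodule_le fun c q => ⟨_, hcol c q.1 q.2⟩
  · rintro ⟨c, k, e⟩ s _
    simp only [pow_add, ← mul_assoc]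
    rw [hcol]
    exact rePart_freqDataMatrix_mem L hU hY _ _

end

/-! ### Equivalence of the predictive control problems -/

theorem theorem3 {nx nu ny N E M Tp T : ℕ} (hE : 1 ≤ E) (hM : 1 ≤ M) (hT : 1 ≤ T)
    (S : LTISystem nx nu ny) (hS : S.Controllable) (hTp : S.obsIndex ≤ Tp)
    (Ud : Fin E → Fin M → Fin nu → ℂ) (Yd : Fin E → Fin M → Fin ny → ℂ)
    (hUY : ∀ e, S.IsIOSpectrum (Ud e) (Yd e))
    (ud : Fin N → Fin nu → ℝ) (yd : Fin N → Fin ny → ℝ)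
    (huy : S.IsIOTrajectory ud yd)
    (hCPE : IsCPE (Tp + T + nx) Ud) (hPE : IsPE (Tp + T + nx) ud)
    (P : ControlSpec nu ny) (hP : 0 < P.slackWeight) :
    (∀ (u : ℤ → Fin nu → ℝ) (y : ℤ → Fin ny → ℝ) (k : ℤ),
      P.freePCOptimal T 0 Ud Yd (pastWindow Tp u k) (pastWindow Tp y k) =
        P.deePCOptimal T 0 ud yd (pastWindow Tp u k) (pastWindow Tp y k)) ∧
    {w | ∃ G0 G1, (fun r => (w r : ℂ)) = freqDataMatrix (Tp + T) Ud Yd *ᵥ symVec G0 G1} =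
      Set.range fun g => timeDataMatrix (Tp + T) ud yd *ᵥ g := by
  have hset : {w | ∃ G0 G1, (fun r => (w r : ℂ)) =
      freqDataMatrix (Tp + T) Ud Yd *ᵥ symVec G0 G1} =
      Set.range fun g => timeDataMatrix (Tp + T) ud yd *ᵥ g :=
    congrArg SetLike.coe ((freqSubmodule_eq_range S hS hUY hCPE).trans
      (range_timeDataMatrix (by omega) S hS huy hPE).symm)
  refine ⟨fun u y k => ?_, hset⟩
  -- With weight `0` the costs do not depend on `G` and `g`, so only their existence matters.
  have hfeas : ∀ u' y' σ,
      (∃ G0 G1, P.FreePCFeasible (T := T) Ud Yd (pastWindow Tp u k) (pastWindow Tp y k)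
        u' y' G0 G1 σ) ↔
      ∃ g, P.DeePCFeasible (T := T) ud yd (pastWindow Tp u k) (pastWindow Tp y k) u' y' g σ := by
    intro u' y' σ
    have hmem := (Set.ext_iff.1 hset
      (stackIO (Fin.append (pastWindow Tp u k) u')
        (Fin.append (pastWindow Tp y k + σ) y'))).trans (exists_congr fun _ => eq_comm)
    simp only [Set.mem_ofPred_eq] at hmem
    simp only [ControlSpec.FreePCFeasible, ControlSpec.DeePCFeasible, exists_and_right, hmem]
  ext ⟨u', y'⟩
  simp only [ControlSpec.freePCOptimal, ControlSpec.deePCOptimal, ControlSpec.freePCCost,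
    ControlSpec.deePCCost, zero_mul, add_zero, Set.mem_ofPred_eq]
  constructor
  · rintro ⟨G0, G1, σ, hf, hopt⟩
    obtain ⟨g, hg⟩ := (hfeas _ _ _).1 ⟨G0, G1, hf⟩
    refine ⟨g, σ, hg, fun u₂ y₂ g₂ σ₂ h₂ => ?_⟩
    obtain ⟨H0, H1, hH⟩ := (hfeas _ _ _).2 ⟨g₂, h₂⟩
    exact hopt _ _ _ _ _ hH
  · rintro ⟨g, σ, hf, hopt⟩
    obtain ⟨G0, G1, hG⟩ := (hfeas _ _ _).2 ⟨g, hf⟩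
    refine ⟨G0, G1, σ, hG, fun u₂ y₂ H0 H1 σ₂ h₂ => ?_⟩
    obtain ⟨g₂, hg₂⟩ := (hfeas _ _ _).1 ⟨H0, H1, h₂⟩
    exact hopt _ _ _ _ hg₂
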